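/- Let $\Gamma$ be a finite simple graph with vertex set $X$, let $G$ be the right-angled Artin group and $M$ the right-angled Artin monoid defined by $\Gamma$ (generators $X$, one relation $ab=ba$ for each edge $a-b$). Fix a total order $<$ on $X\cup X^{-1}$ such that for each edge $a-b$ either $a^{\varepsilon}<b^{\delta}$ for all signs $\varepsilon,\delta=\pm1$, or $a^{\varepsilon}>b^{\delta}$ for all signs, and order words by the induced length-lexicographical order. Let $\Re_0$ be the rewriting system on $(X\cup X^{-1})^*$ consisting of the rules $a^{\varepsilon}b^{\delta}\to b^{\delta}a^{\varepsilon}$ ($a-b$ an edge, $a^{\varepsilon}>b^{\delta}$, $\varepsilon,\delta=\pm1$) and $aa^{-1}\to1$, $a^{-1}a\to1$ ($a\in X$). A run of the Knuth-Bendix completion algorithm on $\Re_0$ is a sequence $\Re_0\subseteq\Re_1\subseteq\Re_2\subseteq\cdots$ such that every rule of $\Re_{n+1}\setminus\Re_n$ is obtained by reducing both words of a critical pair of $\Re_n$ (from an overlap or an inclusion of left-hand sides) to irreducible words modulo $\Re_n$ and orienting the two distinct results from the larger to the smaller one, and such that for every $n$ and every overlap of rules of $\Re_n$ the two words of its critical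 pair have a common descendant modulo $\Re_m$ for some $m$. Write $\Re=\bigcup_n\Re_n$ for the system obtained from the run, and for a system $S$ write $S^+$ for the set of its rules whose left-hand side is a positive word (a word in $X^*$). Then such runs exist, and for every run: 1. $\Re$ is complete (terminating and confluent) and equivalent to $\Re_0$ (the two systems generate the same congruence). 2. $\Re^+$ is a rewriting system for $M$: every rule of $\Re^+$ has a positive right-hand side, and $M$ is isomorphic to the factor monoid $X^*/\equiv_{\Re^+}$, by an isomorphism that is the identity on the generators. 3. At every step $n$ of the run, $\Re_n^+$ is likewise a rewriting system for $M$, in the same sense. -/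

import Mathlib

namespace RightAngledArtin

/-! ### Rewriting systems on words -/

/-- A rewriting system on the alphabet `A`: a set of rules `(l, r)`, read `l → r`. -/
abbrev RewritingSystem (A : Type*) := Set (List A × List A)

/-- One reduction step: `u l v → u r v` for a rule `(l, r)`. -/
def Reduces {A : Type*} (R : RewritingSystem A) (w z : List A) : Prop :=
  ∃ u v l r : List A, (l, r) ∈ R ∧ w = u ++ l ++ v ∧ z = u ++ r ++ v

/-- The reflexive transitive closure `→*` of the reduction relation. -/
def ReducesStar {A : Type*} (R : RewritingSystem A) : List A → List A → Prop :=
  Relation.ReflTransGen (Reduces R)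

/-- The congruence `≡_R` (also written `↔*`): the equivalence relation generated by reduction. -/
def Congruent {A : Type*} (R : RewritingSystem A) : List A → List A → Prop :=
  Relation.EqvGen (Reduces R)

def IsIrreducible {A : Type*} (R : RewritingSystem A) (w : List A) : Prop :=
  ¬ ∃ z, Reduces R w z

/-- Two words have a common descendant. -/
def HaveCommonDescendant {A : Type*} (R : RewritingSystem A) (p q : List A) : Prop :=
  ∃ z, ReducesStar R p z ∧ ReducesStar R q z

def IsTerminating {A : Type*} (R : RewritingSystem A) : Prop :=
  ¬ ∃ w : ℕ → List A, ∀ n, Reduces R (w n) (w (n + 1))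

def IsConfluent {A : Type*} (R : RewritingSystem A) : Prop :=
  ∀ w u v, ReducesStar R w u → ReducesStar R w v → HaveCommonDescendant R u v

def IsComplete {A : Type*} (R : RewritingSystem A) : Prop :=
  IsTerminating R ∧ IsConfluent R

/-- Two rewriting systems are equivalent if they generate the same congruence. -/
def AreEquivalent {A : Type*} (R R' : RewritingSystem A) : Prop :=
  ∀ u v, Congruent R u v ↔ Congruent R' u v

/-! ### Critical pairs and completion -/

/-- `(p, q)` is the critical pair of an overlap ambiguity `u, v, w` (three non-empty words)
between the rules `uv → r₁` and `vw → r₂`. -/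
def IsOverlapPair {A : Type*} (R : RewritingSystem A) (p q : List A) : Prop :=
  ∃ u v w r₁ r₂ : List A, u ≠ [] ∧ v ≠ [] ∧ w ≠ [] ∧
    (u ++ v, r₁) ∈ R ∧ (v ++ w, r₂) ∈ R ∧ p = r₁ ++ w ∧ q = u ++ r₂

/-- `(p, q)` is the critical pair of an inclusion ambiguity between the rules `v → r₁` and
`uvw → r₂`. -/
def IsInclusionPair {A : Type*} (R : RewritingSystem A) (p q : List A) : Prop :=
  ∃ u v w r₁ r₂ : List A, (u = [] → w = [] → r₁ ≠ r₂) ∧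
    (v, r₁) ∈ R ∧ (u ++ v ++ w, r₂) ∈ R ∧ p = u ++ r₁ ++ w ∧ q = r₂

/-- `ρ` is a rule produced from `R` by the completion algorithm, with respect to the
length-lexicographical order induced by the order `lt` of the letters: the two words of some
critical pair of `R` are reduced to irreducible words modulo `R`, and the two resulting words
are oriented from the larger one to the smaller one. -/
def IsProducedRule {A : Type*} (lt : A → A → Prop) (R : RewritingSystem A)
    (ρ : List A × List A) : Prop :=
  ∃ p q p' q' : List A, (IsOverlapPair R p q ∨ IsInclusionPair R p q) ∧
    ReducesStar R p p' ∧ IsIrreducible R p' ∧ ReducesStar R q q' ∧ IsIrreducible R q' ∧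
    (ρ = (p', q') ∧ List.Shortlex lt q' p' ∨ ρ = (q', p') ∧ List.Shortlex lt p' q')

/-- `R 0, R 1, R 2, …` are the systems obtained step by step in a run of the Knuth-Bendix
completion algorithm on `R₀`. Which critical pairs are treated at which step, and which
irreducible descendants are used, is left free; no rule is ever removed. -/
structure IsCompletionRun {A : Type*} (lt : A → A → Prop) (R₀ : RewritingSystem A)
    (R : ℕ → RewritingSystem A) : Prop where
  /-- the run starts from `R₀` -/
  zero : R 0 = R₀
  /-- each step only adds rules -/
  subset_succ : ∀ n, R n ⊆ R (n + 1)
  /-- every rule added is produced from a critical pair of the previous system -/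
  produced : ∀ n, ∀ ρ ∈ R (n + 1), ρ ∉ R n → IsProducedRule lt (R n) ρ
  /-- the algorithm is fair: no overlap is left aside forever, that is, the critical pair of each
  overlap that occurs is resolved by the rules obtained up to some step -/
  fair : ∀ n p q, IsOverlapPair (R n) p q → ∃ m, HaveCommonDescendant (R m) p q

/-- The system obtained from a completion run: the union of all its steps. -/
def limitSystem {A : Type*} (R : ℕ → RewritingSystem A) : RewritingSystem A := ⋃ n, R n

/-! ### Signed letters and positive words -/

/-- The alphabet `X ∪ X⁻¹`: `(a, true)` is the generator `a`, `(a, false)` its inverse. -/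
abbrev Letter (V : Type*) := V × Bool

/-- A word is positive if it contains no inverse of a generator. -/
def IsPositive {V : Type*} (w : List (Letter V)) : Prop := ∀ x ∈ w, x.2 = true

/-- The inclusion of the free monoid `X*` into the words on `X ∪ X⁻¹`. -/
def positiveWord {V : Type*} (w : FreeMonoid V) : List (Letter V) :=
  (FreeMonoid.toList w).map fun a => (a, true)

/-- `R⁺`: the rules of `R` with positive left-hand side. -/
def positivePart {V : Type*} (R : RewritingSystem (Letter V)) : RewritingSystem (Letter V) :=
  {ρ ∈ R | IsPositive ρ.1}

/-- Condition `C⁺`: each rule with positive left-hand side has a positive right-hand side. -/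
def SatisfiesCPlus {V : Type*} (R : RewritingSystem (Letter V)) : Prop :=
  ∀ ρ ∈ R, IsPositive ρ.1 → IsPositive ρ.2

/-- The factor monoid `X* / ≡_{R⁺}`, that is, `Mon⟨X ∣ R⁺⟩`. -/
abbrev PositiveFactorMonoid {V : Type*} (R : RewritingSystem (Letter V)) :=
  PresentedMonoid fun u v : FreeMonoid V => (positiveWord u, positiveWord v) ∈ positivePart R

/-! ### Right-angled Artin monoids -/

/-- The right-angled Artin monoid with defining graph `G`: one generator for each vertex and one
relation `ab = ba` for each edge `a - b`. -/
abbrev ArtinMonoid {V : Type*} (G : SimpleGraph V) :=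
  PresentedMonoid fun u v : FreeMonoid V => ∃ a b, G.Adj a b ∧
    u = FreeMonoid.of a * FreeMonoid.of b ∧ v = FreeMonoid.of b * FreeMonoid.of a

/-- `R⁺` is a rewriting system for the right-angled Artin monoid with defining graph `G`: all
rules of `R⁺` are rules between positive words, and the monoid is isomorphic to `X* / ≡_{R⁺}`, by
an isomorphism that fixes the generators. -/
def PositivePartPresentsArtinMonoid {V : Type*} (G : SimpleGraph V)
    (R : RewritingSystem (Letter V)) : Prop :=
  SatisfiesCPlus R ∧ ∃ e : ArtinMonoid G ≃* PositiveFactorMonoid R,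
    ∀ a : V, e (PresentedMonoid.of _ a) = PresentedMonoid.of _ a

/-- The order of the letters orients the four relations `a^ε b^δ = b^δ a^ε` of each edge `a - b`
in the same direction, whatever the signs. -/
def OrientsEdges {V : Type*} (G : SimpleGraph V) (lt : Letter V → Letter V → Prop) : Prop :=
  ∀ a b, G.Adj a b → ∀ ε δ ε' δ' : Bool, lt (a, ε) (b, δ) → lt (a, ε') (b, δ')

/-- The initial system for the right-angled Artin group with defining graph `G`: the rules
`a^ε b^δ → b^δ a^ε` for each edge `a - b` with `a^ε > b^δ`, and the rules of free reduction
`a a⁻¹ → 1` and `a⁻¹ a → 1`. -/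
def initialSystem {V : Type*} (G : SimpleGraph V) (lt : Letter V → Letter V → Prop) :
    RewritingSystem (Letter V) :=
  {ρ | (∃ (a b : V) (ε δ : Bool), G.Adj a b ∧ lt (b, δ) (a, ε) ∧
        ρ = ([(a, ε), (b, δ)], [(b, δ), (a, ε)])) ∨
      ∃ (a : V) (ε : Bool), ρ = ([(a, ε), (a, !ε)], [])}

end RightAngledArtin

/-!
Call a word normal if it has no factor `x w y` in which `y` commutes with every letter of `w` and
either is the inverse of `x`, or commutes with `x` and is smaller than `x`. The group acts by left
multiplication on the reduced words up to commutation (van der Waerden's trick), so congruent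
reduced words differ by commutations only; normal words are reduced, and two normal words that
differ by commutations are equal, as one sees from their first letters. Hence the normal words are
the smallest words of their congruence classes.

Completeness then means that the irreducible words modulo the limit are normal. In a shortest
factor `x w y` that violates normality, all letters of `w` are smaller than `y`, and every such
factor is a left-hand side of the limit, by induction on `w`: if `x w y → r` is a rule, it overlaps
with `y z → z y`, and since `r z` is smaller than `x w z y`, whose proper factors are normal, this
overlap can only be resolved by a rule with left-hand side `x w z y`.

For the positive part, reduction preserves the exponent sum and does not increase the length, so
it keeps positive words positive; and positive words are reduced, so that congruent ones differ by
commutations only.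
-/

namespace RightAngledArtin

section Rewriting

variable {A : Type*} {R S : RewritingSystem A}

theorem Reduces.of_mem {l r : List A} (h : (l, r) ∈ R) : Reduces R l r :=
  ⟨[], [], l, r, h, by simp, by simp⟩

theorem Reduces.append {u v : List A} (h : Reduces R u v) (p q : List A) :
    Reduces R (p ++ u ++ q) (p ++ v ++ q) := by
  obtain ⟨s, t, l, r, hlr, rfl, rfl⟩ := h
  exact ⟨p ++ s, t ++ q, l, r, hlr, by simp, by simp⟩

theorem ReducesStar.mono (hRS : R ⊆ S) {u v : List A} (h : ReducesStar R u v) :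
    ReducesStar S u v :=
  Relation.ReflTransGen.mono
    (fun _ _ ⟨s, t, l, r, hlr, hu, hv⟩ => ⟨s, t, l, r, hRS hlr, hu, hv⟩) _ _ h

theorem isIrreducible_iff {s : List A} :
    IsIrreducible R s ↔ ∀ l r, (l, r) ∈ R → ¬ l <:+: s := by
  constructor
  · rintro hs l r hlr ⟨p, q, rfl⟩
    exact hs ⟨_, p, q, l, r, hlr, rfl, rfl⟩
  · rintro hs ⟨_, p, q, l, r, hlr, rfl, -⟩
    exact hs l r hlr ⟨p, q, rfl⟩

theorem IsIrreducible.of_infix {s t : List A} (hs : IsIrreducible R s) (hts : t <:+: s) :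
    IsIrreducible R t :=
  isIrreducible_iff.2 fun l r hlr hl => isIrreducible_iff.1 hs l r hlr (hl.trans hts)

theorem IsIrreducible.eq_of_reducesStar {u v : List A} (hu : IsIrreducible R u)
    (h : ReducesStar R u v) : u = v := by
  rcases h.cases_head with rfl | ⟨w, hw, -⟩
  exacts [rfl, absurd ⟨w, hw⟩ hu]

theorem Congruent.refl (u : List A) : Congruent R u u := Relation.EqvGen.refl u

theorem Congruent.symm {u v : List A} (h : Congruent R u v) : Congruent R v u :=
  Relation.EqvGen.symm _ _ h

theorem Congruent.trans {u v w : List A} (huv : Congruent R u v) (hvw : Congruent R v w) :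
    Congruent R u w :=
  Relation.EqvGen.trans _ _ _ huv hvw

theorem Congruent.of_mem {l r : List A} (h : (l, r) ∈ R) : Congruent R l r :=
  Relation.EqvGen.rel _ _ (.of_mem h)

theorem ReducesStar.congruent {u v : List A} (h : ReducesStar R u v) : Congruent R u v :=
  Relation.EqvGen.reflTransGen_le_eqvGen _ _ _ h

theorem Congruent.append {u v : List A} (h : Congruent R u v) (p q : List A) :
    Congruent R (p ++ u ++ q) (p ++ v ++ q) := by
  induction h with
  | rel u v h => exact .rel _ _ (h.append p q)
  | refl u => exact .refl _
  | symm _ _ _ ih => exact ih.symm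
  | trans _ _ _ _ _ ih₁ ih₂ => exact ih₁.trans ih₂

theorem Congruent.append_left {u v : List A} (h : Congruent R u v) (p : List A) :
    Congruent R (p ++ u) (p ++ v) := by
  simpa only [List.append_nil] using h.append p []

theorem Congruent.append_right {u v : List A} (h : Congruent R u v) (q : List A) :
    Congruent R (u ++ q) (v ++ q) :=
  h.append [] q

theorem Congruent.cons {u v : List A} (x : A) (h : Congruent R u v) :
    Congruent R (x :: u) (x :: v) :=
  h.append_left [x]

theorem Congruent.of_rules (hRS : ∀ ρ ∈ R, Congruent S ρ.1 ρ.2) {u v : List A}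
    (h : Congruent R u v) : Congruent S u v := by
  induction h with
  | rel u v h =>
    obtain ⟨s, t, l, r, hlr, rfl, rfl⟩ := h
    exact (hRS _ hlr).append s t
  | refl u => exact .refl _
  | symm _ _ _ ih => exact ih.symm
  | trans _ _ _ _ _ ih₁ ih₂ => exact ih₁.trans ih₂

@[to_additive]
theorem Congruent.prod_map_eq {M : Type*} [Monoid M] (f : A → M)
    (hf : ∀ ρ ∈ R, (ρ.1.map f).prod = (ρ.2.map f).prod) {u v : List A} (h : Congruent R u v) :
    (u.map f).prod = (v.map f).prod := by
  induction h with
  | rel u v h =>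
    obtain ⟨s, t, l, r, hlr, rfl, rfl⟩ := h
    simp only [List.map_append, List.prod_append, hf _ hlr]
  | refl u => rfl
  | symm _ _ _ ih => exact ih.symm
  | trans _ _ _ _ _ ih₁ ih₂ => exact ih₁.trans ih₂

theorem IsOverlapPair.congruent {p q : List A} (h : IsOverlapPair R p q) : Congruent R p q := by
  obtain ⟨u, v, w, r₁, r₂, -, -, -, huv, hvw, rfl, rfl⟩ := h
  have hleft := (Congruent.of_mem huv).append_right w
  have hright := (Congruent.of_mem hvw).append_left u
  rw [← List.append_assoc] at hright
  exact hleft.symm.trans hright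

theorem IsInclusionPair.congruent {p q : List A} (h : IsInclusionPair R p q) :
    Congruent R p q := by
  obtain ⟨u, v, w, r₁, r₂, -, hv, huvw, rfl, rfl⟩ := h
  exact ((Congruent.of_mem hv).append u w).symm.trans (.of_mem huvw)

theorem IsProducedRule.congruent {lt : A → A → Prop} {ρ : List A × List A}
    (h : IsProducedRule lt R ρ) : Congruent R ρ.1 ρ.2 := by
  obtain ⟨p, q, p', q', hpq, hp, -, hq, -, hρ⟩ := h
  have hpq' : Congruent R p' q' := hp.congruent.symm.trans
    ((hpq.elim IsOverlapPair.congruent IsInclusionPair.congruent).trans hq.congruent)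
  rcases hρ with ⟨rfl, -⟩ | ⟨rfl, -⟩
  exacts [hpq', hpq'.symm]

theorem IsProducedRule.shortlex {lt : A → A → Prop} {ρ : List A × List A}
    (h : IsProducedRule lt R ρ) : List.Shortlex lt ρ.2 ρ.1 := by
  obtain ⟨p, q, p', q', -, -, -, -, -, ⟨rfl, h⟩ | ⟨rfl, h⟩⟩ := h
  exacts [h, h]

end Rewriting

section Shortlex

variable {A : Type*} {lt : A → A → Prop} {R : RewritingSystem A}

theorem shortlex_append_append {u v : List A} (h : List.Shortlex lt u v) (w : List A) :
    List.Shortlex lt (u ++ w) (v ++ w) := by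
  rcases List.shortlex_def.1 h with hlen | ⟨hlen, hlex⟩
  · exact .of_length_lt (by simpa using hlen)
  · refine .of_lex (by simpa using hlen) ?_
    clear h
    induction hlex with
    | nil => simp at hlen
    | cons _ ih => exact .cons (ih (by simpa using hlen))
    | rel h => exact .rel h

instance isWellOrder_shortlex [IsWellOrder A lt] : IsWellOrder (List A) (List.Shortlex lt) where
  wf := List.Shortlex.wf IsWellFounded.wf

/-- Every rule of `R` replaces a word by a smaller one in the length-lexicographical order. -/
def IsDecreasing (lt : A → A → Prop) (R : RewritingSystem A) : Prop :=
  ∀ ρ ∈ R, List.Shortlex lt ρ.2 ρ.1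

theorem IsDecreasing.shortlex_of_reduces (hR : IsDecreasing lt R) {u v : List A}
    (h : Reduces R u v) : List.Shortlex lt v u := by
  obtain ⟨s, t, l, r, hlr, rfl, rfl⟩ := h
  exact shortlex_append_append ((hR _ hlr).append_left s) t

theorem IsDecreasing.not_shortlex_of_reducesStar [IsWellOrder A lt] (hR : IsDecreasing lt R)
    {u v : List A} (h : ReducesStar R u v) : ¬ List.Shortlex lt u v := by
  induction h with
  | refl => exact irrefl_of _ u
  | tail _ hvw ih => exact fun huw => ih (_root_.trans huw (hR.shortlex_of_reduces hvw))

theorem IsDecreasing.exists_isIrreducible [IsWellFounded A lt] (hR : IsDecreasing lt R)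
    (u : List A) : ∃ v, ReducesStar R u v ∧ IsIrreducible R v := by
  induction u using (List.Shortlex.wf (r := lt) IsWellFounded.wf).induction with
  | _ u ih =>
    by_cases hu : ∃ v, Reduces R u v
    · obtain ⟨v, huv⟩ := hu
      obtain ⟨w, hvw, hw⟩ := ih v (hR.shortlex_of_reduces huv)
      exact ⟨w, hvw.head huv, hw⟩
    · exact ⟨u, .refl, hu⟩

theorem IsDecreasing.isTerminating [IsWellFounded A lt] (hR : IsDecreasing lt R) :
    IsTerminating R := by
  rintro ⟨w, hw⟩
  exact (wellFounded_iff_isEmpty_descending_chain.1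
    (List.Shortlex.wf (r := lt) IsWellFounded.wf)).false
      ⟨w, fun n => hR.shortlex_of_reduces (hw n)⟩

/-- `u` is a smallest word of its congruence class for the length-lexicographical order. -/
def IsMinimal (lt : A → A → Prop) (R : RewritingSystem A) (u : List A) : Prop :=
  ∀ v, Congruent R u v → ¬ List.Shortlex lt v u

theorem IsMinimal.of_infix {s t : List A} (hs : IsMinimal lt R s) (hts : t <:+: s) :
    IsMinimal lt R t := by
  obtain ⟨p, q, rfl⟩ := hts
  exact fun v htv hvt => hs _ (htv.append p q) (shortlex_append_append (hvt.append_left p) q)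

theorem IsMinimal.eq_of_congruent [Std.Trichotomous lt] {u v : List A}
    (hu : IsMinimal lt R u) (hv : IsMinimal lt R v) (h : Congruent R u v) : u = v :=
  Std.Trichotomous.trichotomous (r := List.Shortlex lt) u v (hv u h.symm) (hu v h)

theorem exists_isMinimal [IsWellFounded A lt] (u : List A) :
    ∃ v, Congruent R u v ∧ IsMinimal lt R v := by
  obtain ⟨v, huv, hv⟩ := (List.Shortlex.wf (r := lt) IsWellFounded.wf).has_min
    {v | Congruent R u v} ⟨u, .refl u⟩
  exact ⟨v, huv, fun w hvw => hv w (huv.trans hvw)⟩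

end Shortlex

section Completion

variable {A : Type*} {lt : A → A → Prop} {R₀ S T : RewritingSystem A}
  {R : ℕ → RewritingSystem A}

/-- `S` is obtained from `R₀` by adding rules that follow from those of `R₀`, and all rules are
oriented by the length-lexicographical order. Every step of a completion run, as well as its
limit, is of this kind. -/
structure IsOrientedExtension (lt : A → A → Prop) (R₀ S : RewritingSystem A) : Prop where
  subset : R₀ ⊆ S
  isDecreasing : IsDecreasing lt S
  congruent : ∀ ρ ∈ S, Congruent R₀ ρ.1 ρ.2

/-- The critical pair of every overlap of rules of `S` has a common descendant. -/
def ResolvesOverlaps (S : RewritingSystem A) : Prop :=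
  ∀ p q, IsOverlapPair S p q → HaveCommonDescendant S p q

theorem IsDecreasing.isOrientedExtension_self (h : IsDecreasing lt R₀) :
    IsOrientedExtension lt R₀ R₀ :=
  ⟨subset_rfl, h, fun _ => .of_mem⟩

theorem IsOrientedExtension.of_isProducedRule (hS : IsOrientedExtension lt R₀ S) (hST : S ⊆ T)
    (hT : ∀ ρ ∈ T, ρ ∉ S → IsProducedRule lt S ρ) : IsOrientedExtension lt R₀ T where
  subset := hS.subset.trans hST
  isDecreasing ρ hρ := by
    by_cases hρS : ρ ∈ S
    exacts [hS.isDecreasing ρ hρS, (hT ρ hρ hρS).shortlex]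
  congruent ρ hρ := by
    by_cases hρS : ρ ∈ S
    exacts [hS.congruent ρ hρS, .of_rules hS.congruent (hT ρ hρ hρS).congruent]

theorem IsOrientedExtension.limitSystem (hR : ∀ n, IsOrientedExtension lt R₀ (R n)) :
    IsOrientedExtension lt R₀ (limitSystem R) where
  subset := (hR 0).subset.trans (Set.subset_iUnion R 0)
  isDecreasing ρ hρ := by
    obtain ⟨n, hn⟩ := Set.mem_iUnion.1 hρ
    exact (hR n).isDecreasing ρ hn
  congruent ρ hρ := by
    obtain ⟨n, hn⟩ := Set.mem_iUnion.1 hρ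
    exact (hR n).congruent ρ hn

theorem IsOrientedExtension.areEquivalent (hS : IsOrientedExtension lt R₀ S) :
    AreEquivalent S R₀ := fun _ _ =>
  ⟨.of_rules hS.congruent, .of_rules fun _ hρ => .of_mem (hS.subset hρ)⟩

theorem IsOrientedExtension.not_isMinimal (hS : IsOrientedExtension lt R₀ S) {l r : List A}
    (hlr : (l, r) ∈ S) : ¬ IsMinimal lt R₀ l :=
  fun hl => hl r (hS.congruent _ hlr) (hS.isDecreasing _ hlr)

theorem IsOrientedExtension.isComplete [IsWellOrder A lt] (hS : IsOrientedExtension lt R₀ S)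
    (hmin : ∀ s, IsIrreducible S s → IsMinimal lt R₀ s) : IsComplete S := by
  refine ⟨hS.isDecreasing.isTerminating, fun w u v hwu hwv => ?_⟩
  obtain ⟨u', huu', hu'⟩ := hS.isDecreasing.exists_isIrreducible u
  obtain ⟨v', hvv', hv'⟩ := hS.isDecreasing.exists_isIrreducible v
  have hu'v' : Congruent S u' v' :=
    (ReducesStar.congruent (hwu.trans huu')).symm.trans (ReducesStar.congruent (hwv.trans hvv'))
  obtain rfl := (hmin u' hu').eq_of_congruent (hmin v' hv') (.of_rules hS.congruent hu'v')
  exact ⟨u', huu', hvv'⟩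

theorem IsCompletionRun.isOrientedExtension (hR : IsCompletionRun lt R₀ R)
    (h₀ : IsDecreasing lt R₀) (n : ℕ) : IsOrientedExtension lt R₀ (R n) := by
  induction n with
  | zero => exact hR.zero ▸ h₀.isOrientedExtension_self
  | succ n ih => exact ih.of_isProducedRule (hR.subset_succ n) (hR.produced n)

theorem IsCompletionRun.resolvesOverlaps_limitSystem (hR : IsCompletionRun lt R₀ R) :
    ResolvesOverlaps (limitSystem R) := by
  have hmono : Monotone R := monotone_nat_of_le_succ hR.subset_succ
  rintro p q ⟨u, v, w, r₁, r₂, hu, hv, hw, huv, hvw, hp, hq⟩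
  obtain ⟨m, hm⟩ := Set.mem_iUnion.1 huv
  obtain ⟨n, hn⟩ := Set.mem_iUnion.1 hvw
  obtain ⟨k, z, hpz, hqz⟩ := hR.fair (max m n) p q ⟨u, v, w, r₁, r₂, hu, hv, hw,
    hmono (le_max_left m n) hm, hmono (le_max_right m n) hn, hp, hq⟩
  exact ⟨z, hpz.mono (Set.subset_iUnion R k), hqz.mono (Set.subset_iUnion R k)⟩

theorem IsOverlapPair.haveCommonDescendant_of_isProducedRule [IsWellOrder A lt]
    (hS : IsDecreasing lt S) (hST : S ⊆ T) (hT : ∀ ρ, IsProducedRule lt S ρ → ρ ∈ T)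
    {p q : List A} (hpq : IsOverlapPair S p q) : HaveCommonDescendant T p q := by
  obtain ⟨p', hpp', hp'⟩ := hS.exists_isIrreducible p
  obtain ⟨q', hqq', hq'⟩ := hS.exists_isIrreducible q
  have hp := hpp'.mono hST
  have hq := hqq'.mono hST
  rcases trichotomous_of (List.Shortlex lt) p' q' with h | rfl | h
  · exact ⟨p', hp, hq.tail (.of_mem (hT (q', p')
      ⟨p, q, p', q', .inl hpq, hpp', hp', hqq', hq', .inr ⟨rfl, h⟩⟩))⟩
  · exact ⟨p', hp, hq⟩
  · exact ⟨q', hp.tail (.of_mem (hT (p', q')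
      ⟨p, q, p', q', .inl hpq, hpp', hp', hqq', hq', .inl ⟨rfl, h⟩⟩)), hq⟩

/-- The run of the completion algorithm that adds, at each step, every rule that can be produced.
It shows that completion runs exist. -/
def exhaustiveRun (lt : A → A → Prop) (R₀ : RewritingSystem A) : ℕ → RewritingSystem A
  | 0 => R₀
  | n + 1 => exhaustiveRun lt R₀ n ∪ {ρ | IsProducedRule lt (exhaustiveRun lt R₀ n) ρ}

theorem isCompletionRun_exhaustiveRun [IsWellOrder A lt] (h₀ : IsDecreasing lt R₀) :
    IsCompletionRun lt R₀ (exhaustiveRun lt R₀) := by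
  have hdec (n : ℕ) : IsDecreasing lt (exhaustiveRun lt R₀ n) := by
    induction n with
    | zero => exact h₀
    | succ n ih =>
      rintro ρ (hρ | hρ)
      exacts [ih ρ hρ, hρ.shortlex]
  exact {
    zero := rfl
    subset_succ := fun n => Set.subset_union_left
    produced := fun n ρ hρ hn => hρ.resolve_left hn
    fair := fun n p q hpq => ⟨n + 1, hpq.haveCommonDescendant_of_isProducedRule (hdec n)
      Set.subset_union_left fun ρ hρ => .inr hρ⟩ }

end Completion

section Trace

variable {A : Type*} {C : SimpleGraph A} {x y : A} {u v w : List A}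

/-- The rules `x y → y x` for each edge `x - y` of the commutation graph `C`, in both directions. -/
def commutationSystem (C : SimpleGraph A) : RewritingSystem A :=
  {ρ | ∃ x y, C.Adj x y ∧ ρ = ([x, y], [y, x])}

/-- Two words are trace equivalent if they are equal in the partially commutative monoid in which
adjacent letters of `C` commute. -/
abbrev TraceEq (C : SimpleGraph A) : List A → List A → Prop := Congruent (commutationSystem C)

instance : Std.Symm (Reduces (commutationSystem C)) where
  symm := by
    rintro _ _ ⟨s, t, _, _, ⟨x, y, hxy, h⟩, rfl, rfl⟩
    obtain ⟨rfl, rfl⟩ := Prod.mk.inj h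
    exact ⟨s, t, [y, x], [x, y], ⟨y, x, hxy.symm, rfl⟩, rfl, rfl⟩

theorem traceEq_swap (hxy : C.Adj x y) (u : List A) : TraceEq C (x :: y :: u) (y :: x :: u) :=
  (Congruent.of_mem (R := commutationSystem C) ⟨x, y, hxy, rfl⟩).append_right u

/-- The word `v` is obtained from `u` by moving an occurrence of `x` to the front of `u`, across
letters that commute with `x`, and deleting it. -/
inductive MovesToFront (C : SimpleGraph A) (x : A) : List A → List A → Prop
  | head (u : List A) : MovesToFront C x (x :: u) u
  | cons {y : A} {u v : List A} : C.Adj x y → MovesToFront C x u v →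
      MovesToFront C x (y :: u) (y :: v)

theorem MovesToFront.traceEq (h : MovesToFront C x u v) : TraceEq C u (x :: v) := by
  induction h with
  | head u => exact .refl _
  | cons hxy _ ih => exact (ih.cons _).trans (traceEq_swap hxy.symm _)

theorem MovesToFront.exists_eq_append (h : MovesToFront C x u v) :
    ∃ p q, u = p ++ x :: q ∧ ∀ z ∈ p, C.Adj x z := by
  induction h with
  | head u => exact ⟨[], u, rfl, by simp⟩
  | @cons y _ _ hxy _ ih =>
    obtain ⟨p, q, rfl, hp⟩ := ih
    exact ⟨y :: p, q, rfl, List.forall_mem_cons.2 ⟨hxy, hp⟩⟩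

theorem MovesToFront.of_reduces (h : MovesToFront C x u v)
    {u' : List A} (huu' : Reduces (commutationSystem C) u u') :
    ∃ v', MovesToFront C x u' v' ∧ TraceEq C v v' := by
  obtain ⟨s, t, _, _, ⟨y, z, hyz, hρ⟩, rfl, rfl⟩ := huu'
  obtain ⟨rfl, rfl⟩ := Prod.mk.inj hρ
  induction s generalizing v with
  | nil =>
    match h with
    | .head _ => exact ⟨_, .cons hyz (.head t), .refl _⟩
    | .cons _ (.head _) => exact ⟨_, .head _, .refl _⟩
    | .cons hxy (.cons hxz h) => exact ⟨_, .cons hxz (.cons hxy h), traceEq_swap hyz _⟩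
  | cons a s ih =>
    cases h with
    | head =>
      exact ⟨_, .head _, .rel _ _ ⟨s, t, _, _, ⟨y, z, hyz, rfl⟩, rfl, rfl⟩⟩
    | cons hxa h =>
      obtain ⟨v', hv', hvv'⟩ := ih h
      exact ⟨a :: v', .cons hxa hv', hvv'.cons a⟩

theorem TraceEq.exists_movesToFront (h : TraceEq C (x :: u) v) :
    ∃ w, MovesToFront C x v w ∧ TraceEq C u w := by
  replace h : Relation.EqvGen (Reduces (commutationSystem C)) (x :: u) v := h
  rw [Relation.EqvGen.eqvGen_eq_reflTransGen] at h
  induction h with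
  | refl => exact ⟨u, .head u, .refl u⟩
  | tail _ hstep ih =>
    obtain ⟨w, hw, huw⟩ := ih
    obtain ⟨w', hw', hww'⟩ := hw.of_reduces hstep
    exact ⟨w', hw', huw.trans hww'⟩

theorem TraceEq.levi (h : TraceEq C (x :: u) (y :: v)) :
    x = y ∧ TraceEq C u v ∨
      C.Adj x y ∧ ∃ w, TraceEq C u (y :: w) ∧ TraceEq C v (x :: w) := by
  obtain ⟨v', hv', huv'⟩ := h.exists_movesToFront
  cases hv' with
  | head => exact .inl ⟨rfl, huv'⟩
  | @cons _ _ w hxy hw => exact .inr ⟨hxy, w, huv', hw.traceEq⟩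

theorem TraceEq.of_cons (h : TraceEq C (x :: u) (x :: v)) : TraceEq C u v := by
  rcases h.levi with ⟨-, huv⟩ | ⟨hxx, -⟩
  exacts [huv, absurd hxx C.irrefl]

/-- Some word trace equivalent to `u` starts with the letter `x`. -/
def StartsWith (C : SimpleGraph A) (x : A) (u : List A) : Prop := ∃ v, TraceEq C u (x :: v)

theorem TraceEq.startsWith_iff (h : TraceEq C u v) : StartsWith C x u ↔ StartsWith C x v :=
  exists_congr fun _ => ⟨h.symm.trans, h.trans⟩

theorem startsWith_cons_of_adj (hxy : C.Adj x y) :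
    StartsWith C x (y :: u) ↔ StartsWith C x u := by
  constructor
  · rintro ⟨v, hv⟩
    rcases hv.levi with ⟨rfl, -⟩ | ⟨-, w, hw, -⟩
    exacts [absurd hxy C.irrefl, ⟨w, hw⟩]
  · rintro ⟨v, hv⟩
    exact ⟨y :: v, (hv.cons y).trans (traceEq_swap hxy.symm v)⟩

end Trace

section Cancellation

variable {V : Type*} {G : SimpleGraph V} {x y : Letter V} {u v w : List (Letter V)}

/-- The formal inverse of a letter. -/
def letterInv (x : Letter V) : Letter V := (x.1, !x.2)

@[simp]
theorem letterInv_letterInv (x : Letter V) : letterInv (letterInv x) = x := by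
  simp [letterInv]

/-- The commutation graph of the signed letters: `a^ε` and `b^δ` commute if `a - b` is an edge. -/
abbrev letterGraph (G : SimpleGraph V) : SimpleGraph (Letter V) := G.comap Prod.fst

theorem letterGraph_adj_letterInv_left :
    (letterGraph G).Adj (letterInv x) y ↔ (letterGraph G).Adj x y := Iff.rfl

theorem letterGraph_adj_letterInv_right :
    (letterGraph G).Adj x (letterInv y) ↔ (letterGraph G).Adj x y := Iff.rfl

/-- No letter of the word can be moved next to a later occurrence of its inverse. -/
def IsReduced (G : SimpleGraph V) : List (Letter V) → Prop
  | [] => True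
  | x :: u => ¬ StartsWith (letterGraph G) (letterInv x) u ∧ IsReduced G u

theorem isReduced_iff_of_reduces (h : Reduces (commutationSystem (letterGraph G)) u v) :
    IsReduced G u ↔ IsReduced G v := by
  obtain ⟨s, t, _, _, ⟨x, y, hxy, hρ⟩, rfl, rfl⟩ := h
  obtain ⟨rfl, rfl⟩ := Prod.mk.inj hρ
  induction s with
  | nil =>
    have hx := startsWith_cons_of_adj (u := t) (letterGraph_adj_letterInv_left.2 hxy)
    have hy := startsWith_cons_of_adj (u := t) (letterGraph_adj_letterInv_left.2 hxy.symm)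
    simp only [List.nil_append, List.cons_append, IsReduced, hx, hy, and_left_comm]
  | cons z s ih =>
    have hstep : TraceEq (letterGraph G) (s ++ [x, y] ++ t) (s ++ [y, x] ++ t) :=
      .rel _ _ ⟨s, t, _, _, ⟨x, y, hxy, rfl⟩, rfl, rfl⟩
    exact and_congr (not_congr hstep.startsWith_iff) ih

theorem TraceEq.isReduced_iff (h : TraceEq (letterGraph G) u v) :
    IsReduced G u ↔ IsReduced G v := by
  induction h with
  | rel u v h => exact isReduced_iff_of_reduces h
  | refl u => rfl
  | symm _ _ _ ih => exact ih.symm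
  | trans _ _ _ _ _ ih₁ ih₂ => exact ih₁.trans ih₂

/-- For reduced words `u` and `v`: the word `v` represents the product of the letter `x` and the
word `u`. The two cases are exchanged by passing to the inverse letter and the converse relation. -/
def IsLeftMul (G : SimpleGraph V) (x : Letter V) (u v : List (Letter V)) : Prop :=
  TraceEq (letterGraph G) v (x :: u) ∨ TraceEq (letterGraph G) u (letterInv x :: v)

theorem IsLeftMul.inv (h : IsLeftMul G x u v) : IsLeftMul G (letterInv x) v u := by
  rw [IsLeftMul, letterInv_letterInv]
  exact h.symm

theorem IsReduced.exists_isLeftMul (hu : IsReduced G u) (x : Letter V) :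
    ∃ v, IsReduced G v ∧ IsLeftMul G x u v := by
  by_cases hx : StartsWith (letterGraph G) (letterInv x) u
  · obtain ⟨v, hv⟩ := hx
    exact ⟨v, (hv.isReduced_iff.1 hu).2, .inr hv⟩
  · exact ⟨x :: u, ⟨hx, hu⟩, .inl (.refl _)⟩

theorem IsLeftMul.traceEq_congr (hv : IsReduced G v) (hw : IsReduced G w)
    {u' : List (Letter V)} (huu' : TraceEq (letterGraph G) u u')
    (huv : IsLeftMul G x u v) (huw : IsLeftMul G x u' w) : TraceEq (letterGraph G) v w := by
  have not_both {s t s' t' : List (Letter V)} (ht : IsReduced G t)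
      (hss' : TraceEq (letterGraph G) s s')
      (hl : TraceEq (letterGraph G) t (x :: s))
      (hr : TraceEq (letterGraph G) s' (letterInv x :: t')) : False :=
    (hl.isReduced_iff.1 ht).1 ⟨t', hss'.trans hr⟩
  rcases huv with huv | huv <;> rcases huw with huw | huw
  · exact huv.trans ((huu'.cons x).trans huw.symm)
  · exact (not_both hv huu' huv huw).elim
  · exact (not_both hw huu'.symm huw huv).elim
  · exact TraceEq.of_cons (huv.symm.trans (huu'.trans huw))

theorem IsLeftMul.exists_comm (hxy : (letterGraph G).Adj x y) (hv : IsReduced G v)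
    (hw : IsReduced G w) (huv : IsLeftMul G x u v) (huw : IsLeftMul G y u w) :
    ∃ t, IsReduced G t ∧ IsLeftMul G y v t ∧ IsLeftMul G x w t := by
  have mixed {x y : Letter V} (hxy : (letterGraph G).Adj x y) {v w : List (Letter V)}
      (hw : IsReduced G w) (huv : TraceEq (letterGraph G) u (letterInv x :: v))
      (huw : TraceEq (letterGraph G) w (y :: u)) :
      ∃ t, IsReduced G t ∧ IsLeftMul G y v t ∧ IsLeftMul G x w t := by
    have hwt : TraceEq (letterGraph G) w (letterInv x :: y :: v) := huw.trans ((huv.cons y).trans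
      (traceEq_swap (letterGraph_adj_letterInv_right.2 hxy.symm) v))
    exact ⟨y :: v, (hwt.isReduced_iff.1 hw).2, .inl (.refl _), .inr hwt⟩
  rcases huv with huv | huv <;> rcases huw with huw | huw
  · refine ⟨x :: y :: u, ⟨?_, huw.isReduced_iff.1 hw⟩,
      .inl ((traceEq_swap hxy u).trans (huv.symm.cons y)), .inl (huw.symm.cons x)⟩
    rw [startsWith_cons_of_adj (letterGraph_adj_letterInv_left.2 hxy)]
    exact (huv.isReduced_iff.1 hv).1
  · obtain ⟨t, ht, hwt, hvt⟩ := mixed hxy.symm hv huw huv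
    exact ⟨t, ht, hvt, hwt⟩
  · exact mixed hxy hw huv huw
  · rcases TraceEq.levi (huv.symm.trans huw) with ⟨hinv, -⟩ | ⟨-, t, hvt, hwt⟩
    · exact absurd (hinv ▸ letterGraph_adj_letterInv_left.2 hxy : (letterGraph G).Adj
        (letterInv y) y) G.irrefl
    · exact ⟨t, (hvt.isReduced_iff.1 hv).2, .inr hvt, .inr hwt⟩

/-- The set of reduced words up to commutation. The group acts on it by left multiplication. -/
def ReducedTrace (G : SimpleGraph V) : Type _ :=
  Quotient ((Relation.EqvGen.setoid (Reduces (commutationSystem (letterGraph G)))).comap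
    (Subtype.val : {u // IsReduced G u} → List (Letter V)))

/-- The class of a reduced word. -/
def ReducedTrace.mk (u : List (Letter V)) (hu : IsReduced G u) : ReducedTrace G :=
  Quotient.mk _ ⟨u, hu⟩

theorem ReducedTrace.mk_eq_mk {hu : IsReduced G u} {hv : IsReduced G v} :
    mk u hu = mk v hv ↔ TraceEq (letterGraph G) u v :=
  Quotient.eq

theorem ReducedTrace.exists_mk_eq (q : ReducedTrace G) : ∃ u hu, mk u hu = q :=
  Quotient.inductionOn q fun u => ⟨u.1, u.2, rfl⟩

/-- Left multiplication by a letter on the reduced words up to commutation. -/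
noncomputable def leftMul (x : Letter V) : Function.End (ReducedTrace G) :=
  Quotient.map' (fun u => ⟨_, (u.2.exists_isLeftMul x).choose_spec.1⟩) fun u v huv =>
    have hu := (u.2.exists_isLeftMul x).choose_spec
    have hv := (v.2.exists_isLeftMul x).choose_spec
    IsLeftMul.traceEq_congr hu.1 hv.1 huv hu.2 hv.2

theorem IsLeftMul.leftMul_mk {hu : IsReduced G u} {hv : IsReduced G v} (h : IsLeftMul G x u v) :
    leftMul x (ReducedTrace.mk u hu) = ReducedTrace.mk v hv :=
  have hux := (hu.exists_isLeftMul x).choose_spec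
  ReducedTrace.mk_eq_mk.2 (IsLeftMul.traceEq_congr hux.1 hv (.refl u) hux.2 h)

theorem leftMul_mul_leftMul_letterInv (x : Letter V) :
    (leftMul x * leftMul (letterInv x) : Function.End (ReducedTrace G)) = 1 := by
  funext q
  obtain ⟨u, hu, rfl⟩ := q.exists_mk_eq
  obtain ⟨v, hv, huv⟩ := hu.exists_isLeftMul (letterInv x)
  have hvu : IsLeftMul G x v u := letterInv_letterInv x ▸ huv.inv
  change leftMul x (leftMul (letterInv x) (ReducedTrace.mk u hu)) = ReducedTrace.mk u hu
  rw [huv.leftMul_mk (hv := hv), hvu.leftMul_mk]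

theorem leftMul_mul_comm (hxy : (letterGraph G).Adj x y) :
    (leftMul x * leftMul y : Function.End (ReducedTrace G)) = leftMul y * leftMul x := by
  funext q
  obtain ⟨u, hu, rfl⟩ := q.exists_mk_eq
  obtain ⟨v, hv, huv⟩ := hu.exists_isLeftMul x
  obtain ⟨w, hw, huw⟩ := hu.exists_isLeftMul y
  obtain ⟨t, ht, hvt, hwt⟩ := huv.exists_comm hxy hv hw huw
  change leftMul x (leftMul y (ReducedTrace.mk u hu)) =
    leftMul y (leftMul x (ReducedTrace.mk u hu))
  rw [huv.leftMul_mk (hv := hv), huw.leftMul_mk (hv := hw), hvt.leftMul_mk (hv := ht),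
    hwt.leftMul_mk]

theorem IsReduced.prod_leftMul (hu : IsReduced G u) :
    (u.map leftMul).prod (ReducedTrace.mk [] trivial) = ReducedTrace.mk u hu := by
  induction u with
  | nil => rfl
  | cons x u ih =>
    have hxu : IsLeftMul G x u (x :: u) := .inl (.refl _)
    rw [List.map_cons, List.prod_cons]
    exact (congrArg (leftMul x) (ih hu.2)).trans hxu.leftMul_mk

theorem mem_initialSystem_of_adj {lt : Letter V → Letter V → Prop}
    (hxy : (letterGraph G).Adj x y) (hlt : lt y x) : ([x, y], [y, x]) ∈ initialSystem G lt :=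
  .inl ⟨x.1, y.1, x.2, y.2, hxy, hlt, rfl⟩

theorem mem_initialSystem_letterInv {lt : Letter V → Letter V → Prop} (x : Letter V) :
    ([x, letterInv x], []) ∈ initialSystem G lt :=
  .inr ⟨x.1, x.2, rfl⟩

theorem Congruent.traceEq {lt : Letter V → Letter V → Prop}
    (h : Congruent (initialSystem G lt) u v) (hu : IsReduced G u) (hv : IsReduced G v) :
    TraceEq (letterGraph G) u v := by
  have hprod := h.prod_map_eq (leftMul (G := G)) ?_
  · exact ReducedTrace.mk_eq_mk.1
      (hu.prod_leftMul.symm.trans ((congrFun hprod _).trans hv.prod_leftMul))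
  rintro _ (⟨a, b, ε, δ, hab, -, rfl⟩ | ⟨a, ε, rfl⟩)
  · simpa using leftMul_mul_comm (x := (a, ε)) (y := (b, δ)) hab
  · simpa [letterInv] using leftMul_mul_leftMul_letterInv (G := G) (a, ε)

end Cancellation

section Normal

variable {V : Type*} {G : SimpleGraph V} {lt : Letter V → Letter V → Prop} {x y : Letter V}
  {u v w s t : List (Letter V)}

/-- In the word `x w y`, the letter `y` can be moved next to `x`, where it cancels or forms a
decreasing pair of commuting letters. -/
def IsBadFactor (G : SimpleGraph V) (lt : Letter V → Letter V → Prop) (x : Letter V)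
    (w : List (Letter V)) (y : Letter V) : Prop :=
  ((letterGraph G).Adj y x ∧ lt y x ∨ y = letterInv x) ∧ ∀ z ∈ w, (letterGraph G).Adj y z

/-- Words without bad factor. They turn out to be the smallest words of their congruence classes
modulo the initial system, see `isNormal_iff_isMinimal`. -/
def IsNormal (G : SimpleGraph V) (lt : Letter V → Letter V → Prop) (s : List (Letter V)) : Prop :=
  ∀ x w y, x :: (w ++ [y]) <:+: s → ¬ IsBadFactor G lt x w y

theorem IsNormal.of_infix (hs : IsNormal G lt s) (hts : t <:+: s) : IsNormal G lt t :=
  fun x w y h => hs x w y (h.trans hts)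

theorem IsNormal.of_cons (hs : IsNormal G lt (x :: s)) : IsNormal G lt s :=
  hs.of_infix (List.suffix_cons x s).isInfix

theorem IsNormal.isReduced (hs : IsNormal G lt s) : IsReduced G s := by
  induction s with
  | nil => trivial
  | cons x s ih =>
    refine ⟨fun ⟨v, hv⟩ => ?_, ih hs.of_cons⟩
    obtain ⟨_, hw, -⟩ := TraceEq.exists_movesToFront hv.symm
    obtain ⟨p, q, rfl, hp⟩ := hw.exists_eq_append
    exact hs x p (letterInv x) ⟨[], q, by simp⟩ ⟨.inr rfl, hp⟩

theorem IsNormal.not_lt_of_traceEq [Std.Irrefl lt] (hv : IsNormal G lt (y :: v))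
    (h : TraceEq (letterGraph G) (x :: u) (y :: v)) : ¬ lt x y := by
  intro hxy
  obtain ⟨_, hw, -⟩ := h.exists_movesToFront
  cases hw with
  | head => exact irrefl_of lt x hxy
  | cons hadj hw =>
    obtain ⟨p, q, rfl, hp⟩ := hw.exists_eq_append
    exact hv y p x ⟨[], q, by simp⟩ ⟨.inl ⟨hadj, hxy⟩, hp⟩

theorem IsNormal.eq_of_traceEq [Std.Irrefl lt] [Std.Trichotomous lt] (hu : IsNormal G lt u)
    (hv : IsNormal G lt v) (h : TraceEq (letterGraph G) u v) : u = v := by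
  induction u generalizing v with
  | nil =>
    cases v with
    | nil => rfl
    | cons y v =>
      obtain ⟨_, hw, -⟩ := TraceEq.exists_movesToFront h.symm
      nomatch hw
  | cons x u ih =>
    cases v with
    | nil =>
      obtain ⟨_, hw, -⟩ := h.exists_movesToFront
      nomatch hw
    | cons y v =>
      obtain rfl : x = y := Std.Trichotomous.trichotomous (r := lt) x y
        (hv.not_lt_of_traceEq h) (hu.not_lt_of_traceEq (Congruent.symm h))
      rw [ih hu.of_cons hv.of_cons (TraceEq.of_cons h)]

theorem IsNormal.eq_of_congruent [Std.Irrefl lt] [Std.Trichotomous lt] (hu : IsNormal G lt u)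
    (hv : IsNormal G lt v) (h : Congruent (initialSystem G lt) u v) : u = v :=
  hu.eq_of_traceEq hv (h.traceEq hu.isReduced hv.isReduced)

theorem isDecreasing_initialSystem : IsDecreasing lt (initialSystem G lt) := by
  rintro ρ (⟨a, b, ε, δ, -, hlt, rfl⟩ | ⟨a, ε, rfl⟩)
  exacts [.of_lex rfl (.rel hlt), .of_length_lt (by simp)]

theorem TraceEq.congruent_initialSystem [Std.Trichotomous lt]
    (h : TraceEq (letterGraph G) u v) : Congruent (initialSystem G lt) u v := by
  refine h.of_rules ?_
  rintro _ ⟨x, y, hxy, rfl⟩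
  rcases trichotomous_of lt x y with hlt | rfl | hlt
  · exact (Congruent.of_mem (mem_initialSystem_of_adj hxy.symm hlt)).symm
  · exact .refl _
  · exact .of_mem (mem_initialSystem_of_adj hxy hlt)

theorem traceEq_append_singleton {A : Type*} {C : SimpleGraph A} {y : A} {w : List A}
    (hw : ∀ z ∈ w, C.Adj y z) : TraceEq C (w ++ [y]) (y :: w) := by
  induction w with
  | nil => exact .refl _
  | cons z w ih =>
    rw [List.forall_mem_cons] at hw
    exact ((ih hw.2).cons z).trans (traceEq_swap hw.1.symm w)

theorem IsBadFactor.not_isMinimal [Std.Trichotomous lt] (h : IsBadFactor G lt x w y) :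
    ¬ IsMinimal lt (initialSystem G lt) (x :: (w ++ [y])) := by
  have hmove := (traceEq_append_singleton h.2).cons x
  intro hmin
  rcases h.1 with ⟨hyx, hlt⟩ | rfl
  · exact hmin (y :: x :: w)
      (TraceEq.congruent_initialSystem (hmove.trans (traceEq_swap hyx.symm w)))
      (.of_lex (by simp) (.rel hlt))
  · exact hmin w ((TraceEq.congruent_initialSystem hmove).trans
      ((Congruent.of_mem (mem_initialSystem_letterInv x)).append_right w))
      (.of_length_lt (by simp))

theorem isNormal_iff_isMinimal [IsWellOrder (Letter V) lt] :
    IsNormal G lt s ↔ IsMinimal lt (initialSystem G lt) s := by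
  have isNormal_of_isMinimal {t : List (Letter V)} (ht : IsMinimal lt (initialSystem G lt) t) :
      IsNormal G lt t := fun x w y hi hbad => hbad.not_isMinimal (ht.of_infix hi)
  refine ⟨fun hs => ?_, isNormal_of_isMinimal⟩
  obtain ⟨t, hst, ht⟩ := exists_isMinimal (lt := lt) (R := initialSystem G lt) s
  rwa [hs.eq_of_congruent (isNormal_of_isMinimal ht) hst]

theorem IsNormal.append_singleton [Std.Asymm lt] (hw : IsNormal G lt w)
    (hwy : ∀ z ∈ w, (letterGraph G).Adj y z ∧ lt z y) : IsNormal G lt (w ++ [y]) := by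
  intro x v y' hi hbad
  rcases List.infix_concat_iff.1 hi with hsuffix | hi
  · rcases List.suffix_concat_iff.1 hsuffix with hnil | ⟨t, ht, htw⟩
    · exact List.cons_ne_nil _ _ hnil
    obtain ⟨rfl, hy⟩ := List.append_inj' (s₁ := x :: v) ht rfl
    obtain rfl : y' = y := List.singleton_injective hy
    obtain ⟨hadj, hlt⟩ := hwy x (htw.mem List.mem_cons_self)
    rcases hbad.1 with ⟨-, hgt⟩ | rfl
    exacts [asymm_of lt hlt hgt, G.irrefl hadj]
  · exact hw x v y' hi hbad

end Normal

section Confluence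

variable {V : Type*} {G : SimpleGraph V} {lt : Letter V → Letter V → Prop} {x y z : Letter V}
  {r s w : List (Letter V)} {S : RewritingSystem (Letter V)}

theorem Congruent.of_cons {u v : List (Letter V)}
    (h : Congruent (initialSystem G lt) (x :: u) (x :: v)) :
    Congruent (initialSystem G lt) u v := by
  have hx : Congruent (initialSystem G lt) [letterInv x, x] [] := by
    simpa only [letterInv_letterInv] using
      Congruent.of_mem (mem_initialSystem_letterInv (G := G) (lt := lt) (letterInv x))
  exact (hx.append_right u).symm.trans ((h.append_left [letterInv x]).trans (hx.append_right v))

theorem infix_cons_append_singleton {A : Type*} {x y : A} {l m : List A}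
    (h : l <:+: x :: (m ++ [y])) : l = x :: (m ++ [y]) ∨ l <:+: x :: m ∨ l <:+: m ++ [y] := by
  rcases List.infix_cons_iff.1 h with hprefix | hinfix
  · rw [← List.cons_append, List.prefix_concat_iff] at hprefix
    exact hprefix.imp_right fun hprefix => .inl hprefix.isInfix
  · exact .inr (.inr hinfix)

theorem IsOrientedExtension.shortlex_append_swap
    (hS : IsOrientedExtension lt (initialSystem G lt) S) (hr : (x :: (w ++ [y]), r) ∈ S)
    (hwy : IsMinimal lt (initialSystem G lt) (w ++ [y])) :
    List.Shortlex lt (r ++ [z]) (x :: w ++ [z, y]) := by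
  rcases List.shortlex_def.1 (hS.isDecreasing _ hr) with hlen | ⟨hlen, hlex⟩
  · exact .of_length_lt (by simpa using hlen)
  · cases hlex with
    | nil => simp at hlen
    | rel hlt => exact .of_lex (by simpa using hlen) (.rel hlt)
    | cons hlex =>
      exact absurd (.of_lex (by simpa using hlen) hlex) (hwy _ (hS.congruent _ hr).of_cons)

theorem IsOrientedExtension.exists_rule_append_singleton [IsWellOrder (Letter V) lt]
    (hS : IsOrientedExtension lt (initialSystem G lt) S) (hov : ResolvesOverlaps S)
    (hr : (x :: (w ++ [y]), r) ∈ S) (hyz : (letterGraph G).Adj y z) (hzy : lt z y)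
    (hxwz : IsNormal G lt (x :: (w ++ [z]))) (hwy : IsNormal G lt (w ++ [y]))
    (hwzy : IsNormal G lt (w ++ [z] ++ [y])) :
    ∃ r', (x :: (w ++ [z] ++ [y]), r') ∈ S := by
  by_contra! hno
  have hirr : IsIrreducible S (x :: w ++ [z, y]) := by
    refine isIrreducible_iff.2 fun l r' hl hi => ?_
    rcases infix_cons_append_singleton (m := w ++ [z]) (by simpa using hi) with rfl | hi | hi
    · exact hno _ hl
    · exact hS.not_isMinimal hl (isNormal_iff_isMinimal.1 (hxwz.of_infix hi))
    · exact hS.not_isMinimal hl (isNormal_iff_isMinimal.1 (hwzy.of_infix hi))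
  obtain ⟨t, hrt, ht⟩ := hov (r ++ [z]) (x :: w ++ [z, y])
    ⟨x :: w, [y], [z], r, [z, y], by simp, by simp, by simp, hr,
      hS.subset (mem_initialSystem_of_adj hyz hzy), rfl, rfl⟩
  obtain rfl := hirr.eq_of_reducesStar ht
  exact hS.isDecreasing.not_shortlex_of_reducesStar hrt
    (hS.shortlex_append_swap hr (isNormal_iff_isMinimal.1 hwy))

theorem IsOrientedExtension.exists_rule [IsWellOrder (Letter V) lt]
    (hS : IsOrientedExtension lt (initialSystem G lt) S) (hov : ResolvesOverlaps S)
    (hbad : IsBadFactor G lt x w y) (hlt : ∀ z ∈ w, lt z y) (hxw : IsNormal G lt (x :: w)) :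
    ∃ r, (x :: (w ++ [y]), r) ∈ S := by
  obtain ⟨hxy, hadj⟩ := hbad
  induction w using List.reverseRecOn with
  | nil =>
    rcases hxy with ⟨hyx, hlt⟩ | rfl
    · exact ⟨_, hS.subset (mem_initialSystem_of_adj hyx.symm hlt)⟩
    · exact ⟨_, hS.subset (mem_initialSystem_letterInv x)⟩
  | append_singleton w z ih =>
    have hwz : ∀ t ∈ w ++ [z], (letterGraph G).Adj y t ∧ lt t y :=
      fun t ht => ⟨hadj t ht, hlt t ht⟩
    have hw : ∀ t ∈ w, (letterGraph G).Adj y t ∧ lt t y :=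
      fun t ht => hwz t (List.mem_append_left [z] ht)
    have hxw' : IsNormal G lt (x :: w) := hxw.of_infix ⟨[], [z], by simp⟩
    obtain ⟨r, hr⟩ := ih (fun t ht => (hw t ht).2) hxw' fun t ht => (hw t ht).1
    obtain ⟨hyz, hzy⟩ := hwz z (by simp)
    exact hS.exists_rule_append_singleton hov hr hyz hzy hxw
      (hxw'.of_cons.append_singleton hw) (hxw.of_cons.append_singleton hwz)

theorem IsOrientedExtension.isNormal_of_isIrreducible [IsWellOrder (Letter V) lt]
    (hS : IsOrientedExtension lt (initialSystem G lt) S) (hov : ResolvesOverlaps S)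
    (hs : IsIrreducible S s) : IsNormal G lt s := by
  induction hn : s.length using Nat.strong_induction_on generalizing s with
  | _ n ih =>
    subst hn
    intro x w y hi hbad
    have hfactor := hs.of_infix hi
    have hlen : w.length + 1 < s.length := by simpa using hi.length_le
    have hxw : IsNormal G lt (x :: w) :=
      ih _ (by simpa using hlen) (hfactor.of_infix ⟨[], [y], by simp⟩) rfl
    have hwy : IsNormal G lt (w ++ [y]) :=
      ih _ (by simpa using hlen) (hfactor.of_infix (List.suffix_cons x _).isInfix) rfl
    have hlt : ∀ z ∈ w, lt z y := by
      intro z hz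
      have hadj := hbad.2 z hz
      obtain ⟨p, q, rfl⟩ := List.append_of_mem hz
      have hyz : ¬ lt y z := fun hyz => hwy z q y ⟨p, [], by simp⟩
        ⟨.inl ⟨hadj, hyz⟩, fun t ht => hbad.2 t (by simp [ht])⟩
      exact (trichotomous_of lt z y).resolve_right (not_or_intro hadj.ne' hyz)
    obtain ⟨r, hr⟩ := hS.exists_rule hov hbad hlt hxw
    exact isIrreducible_iff.1 hs _ _ hr hi

end Confluence

section Positive

variable {V : Type*} {G : SimpleGraph V} {lt : Letter V → Letter V → Prop}
  {S : RewritingSystem (Letter V)}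

/-- The sum of the exponents `±1` of the letters of a word. -/
def exponentSum (w : List (Letter V)) : ℤ := (w.map fun x => if x.2 then 1 else -1).sum

theorem Congruent.exponentSum_eq {u v : List (Letter V)}
    (h : Congruent (initialSystem G lt) u v) : exponentSum u = exponentSum v := by
  refine h.sum_map_eq _ ?_
  rintro _ (⟨a, b, ε, δ, -, -, rfl⟩ | ⟨a, ε, rfl⟩)
  · simp [add_comm]
  · cases ε <;> simp

theorem exponentSum_add_two_mul_countP (w : List (Letter V)) :
    exponentSum w + 2 * (w.countP fun x => !x.2) = w.length := by
  induction w with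
  | nil => rfl
  | cons x w ih =>
    have hcons : exponentSum (x :: w) = (if x.2 then 1 else -1) + exponentSum w := List.sum_cons
    rw [hcons, List.countP_cons, List.length_cons]
    grind

theorem isPositive_iff_countP_eq_zero {w : List (Letter V)} :
    IsPositive w ↔ (w.countP fun x => !x.2) = 0 := by
  simp [IsPositive, List.countP_eq_zero]

theorem IsOrientedExtension.satisfiesCPlus (hS : IsOrientedExtension lt (initialSystem G lt) S) :
    SatisfiesCPlus S := by
  intro ρ hρ hpos
  rw [isPositive_iff_countP_eq_zero] at hpos ⊢
  have hexp := (hS.congruent ρ hρ).exponentSum_eq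
  have hleft := exponentSum_add_two_mul_countP ρ.1
  have hright := exponentSum_add_two_mul_countP ρ.2
  have hlen : ρ.2.length ≤ ρ.1.length :=
    (List.shortlex_def.1 (hS.isDecreasing ρ hρ)).elim le_of_lt fun h => h.1.le
  omega

theorem IsPositive.isReduced {w : List (Letter V)} (hw : IsPositive w) : IsReduced G w := by
  induction w with
  | nil => trivial
  | cons x w ih =>
    rw [IsPositive, List.forall_mem_cons] at hw
    refine ⟨fun ⟨v, hv⟩ => ?_, ih hw.2⟩
    obtain ⟨_, hx, -⟩ := TraceEq.exists_movesToFront hv.symm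
    obtain ⟨p, q, rfl, -⟩ := hx.exists_eq_append
    simpa [letterInv, hw.1] using hw.2 (letterInv x) (by simp)

theorem isPositive_positiveWord (u : FreeMonoid V) : IsPositive (positiveWord u) := by
  simp [IsPositive, positiveWord]

theorem artinMonoid_of_mul_of {a b : V} (hab : G.Adj a b) :
    (PresentedMonoid.of _ a * PresentedMonoid.of _ b : ArtinMonoid G) =
      PresentedMonoid.of _ b * PresentedMonoid.of _ a :=
  PresentedMonoid.mk_eq_mk_of_rel ⟨a, b, hab, rfl, rfl⟩

theorem TraceEq.prod_eq {M : Type*} [Monoid M] {f : V → M}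
    (hf : ∀ a b, G.Adj a b → f a * f b = f b * f a) {u v : List (Letter V)}
    (h : TraceEq (letterGraph G) u v) :
    (u.map fun x => f x.1).prod = (v.map fun x => f x.1).prod := by
  refine h.prod_map_eq _ ?_
  rintro _ ⟨x, y, hxy, rfl⟩
  simpa using hf _ _ hxy

/-- The right-angled Artin monoid embeds in the right-angled Artin group. -/
theorem Congruent.lift_artinMonoid_eq {u v : FreeMonoid V}
    (h : Congruent (initialSystem G lt) (positiveWord u) (positiveWord v)) :
    FreeMonoid.lift (fun a => (PresentedMonoid.of _ a : ArtinMonoid G)) u =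
      FreeMonoid.lift (fun a => (PresentedMonoid.of _ a : ArtinMonoid G)) v := by
  have htrace :=
    h.traceEq (isPositive_positiveWord u).isReduced (isPositive_positiveWord v).isReduced
  simpa [positiveWord, Function.comp_def, FreeMonoid.lift_apply] using
    TraceEq.prod_eq (f := fun a => (PresentedMonoid.of _ a : ArtinMonoid G))
      (fun _ _ => artinMonoid_of_mul_of) htrace

theorem positiveFactorMonoid_of_mul_of [Std.Trichotomous lt] (hS : initialSystem G lt ⊆ S)
    {a b : V} (hab : G.Adj a b) :
    (PresentedMonoid.of _ a * PresentedMonoid.of _ b : PositiveFactorMonoid S) =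
      PresentedMonoid.of _ b * PresentedMonoid.of _ a := by
  have of_lt {a b : V} (hab : G.Adj a b) (hlt : lt (b, true) (a, true)) :
      (PresentedMonoid.of _ a * PresentedMonoid.of _ b : PositiveFactorMonoid S) =
        PresentedMonoid.of _ b * PresentedMonoid.of _ a :=
    PresentedMonoid.mk_eq_mk_of_rel (x := FreeMonoid.of a * FreeMonoid.of b)
      (y := FreeMonoid.of b * FreeMonoid.of a)
      ⟨hS (mem_initialSystem_of_adj (x := (a, true)) (y := (b, true)) hab hlt),
        isPositive_positiveWord (FreeMonoid.of a * FreeMonoid.of b)⟩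
  rcases trichotomous_of lt (a, true) (b, true) with hlt | heq | hlt
  · exact (of_lt hab.symm hlt).symm
  · exact absurd (congrArg Prod.fst heq) hab.ne
  · exact of_lt hab hlt

theorem IsOrientedExtension.positivePartPresentsArtinMonoid [Std.Trichotomous lt]
    (hS : IsOrientedExtension lt (initialSystem G lt) S) : PositivePartPresentsArtinMonoid G S := by
  refine ⟨hS.satisfiesCPlus, ?_⟩
  let f : ArtinMonoid G →* PositiveFactorMonoid S :=
    PresentedMonoid.lift (fun a => PresentedMonoid.of _ a) (by
      rintro _ _ ⟨a, b, hab, rfl, rfl⟩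
      simpa using positiveFactorMonoid_of_mul_of hS.subset hab)
  let g : PositiveFactorMonoid S →* ArtinMonoid G :=
    PresentedMonoid.lift (fun a => PresentedMonoid.of _ a) fun u v huv =>
      (hS.congruent _ huv.1).lift_artinMonoid_eq
  exact ⟨MonoidHom.toMulEquiv f g (PresentedMonoid.ext _ fun a => rfl)
    (PresentedMonoid.ext _ fun a => rfl), fun a => rfl⟩

end Positive

end RightAngledArtin

open RightAngledArtin in
theorem proposition4p7_general {V : Type*} (G : SimpleGraph V) (lt : Letter V → Letter V → Prop)
    [IsWellOrder (Letter V) lt] :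
    (∃ R, IsCompletionRun lt (initialSystem G lt) R) ∧
    ∀ R : ℕ → RewritingSystem (Letter V), IsCompletionRun lt (initialSystem G lt) R →
      IsComplete (limitSystem R) ∧
      AreEquivalent (limitSystem R) (initialSystem G lt) ∧
      PositivePartPresentsArtinMonoid G (limitSystem R) ∧
      ∀ n, PositivePartPresentsArtinMonoid G (R n) := by
  refine ⟨⟨_, isCompletionRun_exhaustiveRun isDecreasing_initialSystem⟩, fun R hR => ?_⟩
  have hsteps := hR.isOrientedExtension isDecreasing_initialSystem
  have hlimit := IsOrientedExtension.limitSystem hsteps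
  have hcomplete : IsComplete (limitSystem R) := hlimit.isComplete fun s hs =>
    isNormal_iff_isMinimal.1 (hlimit.isNormal_of_isIrreducible hR.resolvesOverlaps_limitSystem hs)
  exact ⟨hcomplete, hlimit.areEquivalent, hlimit.positivePartPresentsArtinMonoid,
    fun n => (hsteps n).positivePartPresentsArtinMonoid⟩

theorem proposition4p7 {V : Type*} [Finite V] (G : SimpleGraph V)
    (lt : RightAngledArtin.Letter V → RightAngledArtin.Letter V → Prop)
    [IsStrictTotalOrder (RightAngledArtin.Letter V) lt]
    (hlt : RightAngledArtin.OrientsEdges G lt) :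
    (∃ R, RightAngledArtin.IsCompletionRun lt (RightAngledArtin.initialSystem G lt) R) ∧
    ∀ R : ℕ → RightAngledArtin.RewritingSystem (RightAngledArtin.Letter V),
      RightAngledArtin.IsCompletionRun lt (RightAngledArtin.initialSystem G lt) R →
        RightAngledArtin.IsComplete (RightAngledArtin.limitSystem R) ∧
        RightAngledArtin.AreEquivalent (RightAngledArtin.limitSystem R)
          (RightAngledArtin.initialSystem G lt) ∧
        RightAngledArtin.PositivePartPresentsArtinMonoid G
          (RightAngledArtin.limitSystem R) ∧
        ∀ n, RightAngledArtin.PositivePartPresentsArtinMonoid G (R n) := by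
  have : IsWellFounded _ lt := ⟨Finite.wellFounded_of_trans_of_irrefl lt⟩
  have : IsWellOrder _ lt := {}
  exact proposition4p7_general G lt
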